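/- Let $f_+,f_-\colon\mathbb R\to\mathbb R$ be $C^3$ functions. For $\varepsilon>0$ let $\Omega_\varepsilon=\{(x_1,x_2)\in\mathbb R^2: |x_2|\le\varepsilon\}$ and put $f(x_1,\pm\varepsilon)=f_\pm(x_1)$. Let $(S,\mathcal F,\mathbb P)$ be an atomless standard probability space with a filtration $(\mathcal F_n)_{n\ge0}$, where $\mathcal F_0$ is trivial (up to null sets) and the filtration is dense in $\mathcal F$ (every set of $\mathcal F$ is approximated in measure by sets of $\bigcup_n\mathcal F_n$). For $x\in\Omega_\varepsilon$ let $\mathrm{Adm}_\varepsilon(x)$ be the set of pairs $\varphi,\psi\in L^1(S,\mathcal F,\mathbb P)$ with $\mathbb E\varphi=x_1$, $\mathbb E\psi=x_2$, $|\psi|=\varepsilon$ almost everywhere, such that for each $n\ge1$ there is an $\mathcal F_{n-1}$-measurable $\alpha_n$ with $|\alpha_n|=1$ almost everywhere and $\psi_n-\psi_{n-1}=\alpha_n(\varphi_n-\varphi_{n-1})$ almost everywhere, where $\varphi_n=\mathbb E(\varphi\mid\mathcal F_n)$ and $\psi_n=\mathbb E(\psi\mid\mathcal F_n)$. The Bellman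 function is $$\boldsymbol B(x)=\sup\{\mathbb E f(\varphi,\psi):(\varphi,\psi)\in\mathrm{Adm}_\varepsilon(x)\},\qquad x\in\Omega_\varepsilon .$$ **Proposition.** Suppose that $f_+'''$ and $f_-'''$ are bounded on $\mathbb R$ and that $\inf_{t\in\mathbb R}|f_+'(t)-f_-'(t)|>0$. Then there is $\varepsilon_0>0$, depending only on $f_\pm$, such that for every $\varepsilon\in(0,\varepsilon_0)$ and every such probability space and filtration the following holds. For each $x\in\Omega_\varepsilon$ the set $\mathrm{Adm}_\varepsilon(x)$ is nonempty, all the expectations in the definition of $\boldsymbol B(x)$ exist, and $\boldsymbol B(x)$ is finite. Moreover: * if $f_+'-f_-'>0$ on $\mathbb R$, then $\boldsymbol B$ has the simple right foliation $\Omega_{\mathrm R}(-\infty,+\infty)$: it is concave along the lines $x_1\pm x_2=\mathrm{const}$ in $\Omega_\varepsilon$, satisfies $\boldsymbol B(x_1,\pm\varepsilon)=f_\pm(x_1)$, and is linear along each segment $\{x\in\Omega_\varepsilon: x_1-x_2=u\}$, $u\in\mathbb R$; * if $f_+'-f_-'<0$ on $\mathbb R$, then $\boldsymbol B$ has the simple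 left foliation $\Omega_{\mathrm L}(-\infty,+\infty)$: it is concave along the lines $x_1\pm x_2=\mathrm{const}$ in $\Omega_\varepsilon$, satisfies $\boldsymbol B(x_1,\pm\varepsilon)=f_\pm(x_1)$, and is linear along each segment $\{x\in\Omega_\varepsilon: x_1+x_2=u\}$, $u\in\mathbb R$. -/

import Mathlib

open MeasureTheory Set

/-- The horizontal strip `Ω_ε = {(x₁, x₂) : -ε ≤ x₂ ≤ ε}`. -/
def strip (ε : ℝ) : Set (ℝ × ℝ) := {x | -ε ≤ x.2 ∧ x.2 ≤ ε}

/-- The function `f` on the boundary of the strip, `f(x₁, ±ε) = f_±(x₁)`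
(with the irrelevant value `0` off the boundary). -/
noncomputable def boundaryValue (ε : ℝ) (fp fm : ℝ → ℝ) (x : ℝ × ℝ) : ℝ :=
  if x.2 = ε then fp x.1 else if x.2 = -ε then fm x.1 else 0

/-- A filtration `(ℱ n)` in the σ-algebra `m` with `ℱ 0` trivial modulo null sets, and dense:
every measurable set is approximated in measure by sets of the algebras `ℱ n`. -/
structure IsDenseFiltration {S : Type*} {m : MeasurableSpace S} (P : Measure S)
    (ℱ : Filtration ℕ m) : Prop where
  zero_trivial : ∀ A : Set S, MeasurableSet[ℱ 0] A → P A = 0 ∨ P A = 1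
  dense : ∀ A : Set S, MeasurableSet A → ∀ δ : ENNReal, 0 < δ →
    ∃ n : ℕ, ∃ A' : Set S, MeasurableSet[ℱ n] A' ∧ P (symmDiff A A') < δ

/-- The martingale `ψ_n = 𝔼(ψ ∣ ℱ n)` is a transform of `φ_n = 𝔼(φ ∣ ℱ n)` by a predictable
sequence of multipliers of absolute value one: `dψ_{n+1} = α_{n+1} dφ_{n+1}`, where
`α_{n+1}` (written `α n` here) is `ℱ n`-measurable. -/
def IsUnimodularTransform {S : Type*} {m : MeasurableSpace S} (P : Measure S)
    (ℱ : Filtration ℕ m) (φ ψ : S → ℝ) : Prop :=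
  ∃ α : ℕ → S → ℝ, ∀ n : ℕ,
    Measurable[ℱ n] (α n) ∧
    (∀ᵐ s ∂P, |α n s| = 1) ∧
    (∀ᵐ s ∂P, (P[ψ|ℱ (n + 1)]) s - (P[ψ|ℱ n]) s
      = α n s * ((P[φ|ℱ (n + 1)]) s - (P[φ|ℱ n]) s))

/-- The pair `(φ, ψ)` is admissible for the point `x`, i.e. it belongs to `Adm_ε(x)`. -/
structure IsAdmissible {S : Type*} {m : MeasurableSpace S} (P : Measure S)
    (ℱ : Filtration ℕ m) (ε : ℝ) (x : ℝ × ℝ) (φ ψ : S → ℝ) : Prop where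
  integrable_fst : Integrable φ P
  integrable_snd : Integrable ψ P
  transform : IsUnimodularTransform P ℱ φ ψ
  mean_fst : ∫ s, φ s ∂P = x.1
  mean_snd : ∫ s, ψ s ∂P = x.2
  abs_snd : ∀ᵐ s ∂P, |ψ s| = ε

/-- The set of the numbers `𝔼 f(φ, ψ)` over all admissible pairs for `x`. -/
def bellmanValues {S : Type*} {m : MeasurableSpace S} (P : Measure S)
    (ℱ : Filtration ℕ m) (ε : ℝ) (fp fm : ℝ → ℝ) (x : ℝ × ℝ) : Set ℝ :=
  {r | ∃ φ ψ : S → ℝ, IsAdmissible P ℱ ε x φ ψ ∧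
    r = ∫ s, boundaryValue ε fp fm (φ s, ψ s) ∂P}

/-- The Bellman function. -/
noncomputable def bellman {S : Type*} {m : MeasurableSpace S} (P : Measure S)
    (ℱ : Filtration ℕ m) (ε : ℝ) (fp fm : ℝ → ℝ) (x : ℝ × ℝ) : ℝ :=
  sSup (bellmanValues P ℱ ε fp fm x)

/-- The Bellman function is well defined and finite on the strip: all the expectations in its
definition exist, and each supremum is a genuine one (of a nonempty set bounded above). -/
def BellmanWellDefined {S : Type*} {m : MeasurableSpace S} (P : Measure S)
    (ℱ : Filtration ℕ m) (ε : ℝ) (fp fm : ℝ → ℝ) : Prop :=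
  ∀ x ∈ strip ε,
    (∀ φ ψ : S → ℝ, IsAdmissible P ℱ ε x φ ψ →
      Integrable (fun s => boundaryValue ε fp fm (φ s, ψ s)) P) ∧
    IsLUB (bellmanValues P ℱ ε fp fm x) (bellman P ℱ ε fp fm x)

/-- `B` is concave along the directions `x₁ - x₂ = const` and `x₁ + x₂ = const` on `Ω`. -/
def DiagonallyConcaveOn (Ω : Set (ℝ × ℝ)) (B : ℝ × ℝ → ℝ) : Prop :=
  ∀ p ∈ Ω,
    ConcaveOn ℝ {t : ℝ | (p.1 + t, p.2 + t) ∈ Ω} (fun t => B (p.1 + t, p.2 + t)) ∧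
    ConcaveOn ℝ {t : ℝ | (p.1 + t, p.2 - t) ∈ Ω} (fun t => B (p.1 + t, p.2 - t))

/-- `B` coincides on `l` with an affine function. -/
def IsLinearOn (l : Set (ℝ × ℝ)) (B : ℝ × ℝ → ℝ) : Prop :=
  ∃ a b c : ℝ, ∀ x ∈ l, B x = a + b * x.1 + c * x.2

/-- The segment `x₁ - x₂ = u` of the strip. -/
def rightSegment (ε u : ℝ) : Set (ℝ × ℝ) := {x | x ∈ strip ε ∧ x.1 - x.2 = u}

/-- The segment `x₁ + x₂ = u` of the strip. -/
def leftSegment (ε u : ℝ) : Set (ℝ × ℝ) := {x | x ∈ strip ε ∧ x.1 + x.2 = u}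

/-- The subregion `Ω_R` of the strip made up of the segments `x₁ - x₂ = u` with `u ∈ I`. -/
def rightDomain (ε : ℝ) (I : Set ℝ) : Set (ℝ × ℝ) := ⋃ u ∈ I, rightSegment ε u

/-- The subregion `Ω_L` of the strip made up of the segments `x₁ + x₂ = u` with `u ∈ I`. -/
def leftDomain (ε : ℝ) (I : Set ℝ) : Set (ℝ × ℝ) := ⋃ u ∈ I, leftSegment ε u

/-- `B` is diagonally concave with boundary values `f_±` on `Ω_R`, and this subregion is
foliated by right extremal segments, along each of which `B` is linear. -/
structure HasRightFoliation (ε : ℝ) (fp fm : ℝ → ℝ) (B : ℝ × ℝ → ℝ) (I : Set ℝ) : Prop where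
  concave : DiagonallyConcaveOn (rightDomain ε I) B
  boundary : ∀ x ∈ rightDomain ε I, |x.2| = ε → B x = boundaryValue ε fp fm x
  linear : ∀ u ∈ I, IsLinearOn (rightSegment ε u) B

/-- `B` is diagonally concave with boundary values `f_±` on `Ω_L`, and this subregion is
foliated by left extremal segments, along each of which `B` is linear. -/
structure HasLeftFoliation (ε : ℝ) (fp fm : ℝ → ℝ) (B : ℝ × ℝ → ℝ) (I : Set ℝ) : Prop where
  concave : DiagonallyConcaveOn (leftDomain ε I) B
  boundary : ∀ x ∈ leftDomain ε I, |x.2| = ε → B x = boundaryValue ε fp fm x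
  linear : ∀ u ∈ I, IsLinearOn (leftSegment ε u) B

/-! Let `σ = ±1` be the constant sign of `f₊' - f₋'`, and let `G` be the function with boundary
values `f_±` that is linear along each segment `x₁ - σ x₂ = const`. The claim is that `B = G`.

Lower bound: a two-valued `ψ = ±ε` with mean `x₂`, together with `φ = x₁ - σ x₂ + σ ψ`, is
admissible with constant multiplier `σ` and lives on the endpoints of the segment through `x`, so it
attains `G x` (`foliationCandidate_mem_bellmanValues`).

Upper bound: up to a positive factor, the second derivative of `G` along the other diagonal is `-σ
(f₊' - f₋')` at one point plus a Taylor error of size at most `4 M ε²`, where `M` bounds `|f_±'''|`.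
So `G` is diagonally concave in a thin strip (`foliationCandidate_curvature_le`). Then `G(φ_n, ψ_n)`
is a supermartingale starting at `G x`, because its increments follow the diagonals.

The passage to the limit uses Fatou's lemma, which needs a lower bound, while `G` may decrease
cubically. Adding `δ Q`, with `Q ≥ x₁⁴` diagonally concave, supplies the bound; afterwards `δ → 0`
(`IsAdmissible.integral_boundaryValue_le`). -/

open Filter ProbabilityTheory in
/-- An atomless probability measure on a standard Borel space takes all values in `[0, 1]`. -/
theorem exists_measurableSet_measureReal_eq {S : Type*} [MeasurableSpace S] [StandardBorelSpace S]
    (P : Measure S) [IsProbabilityMeasure P] [NullSingletonClass P] {r : ℝ}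
    (h0 : 0 ≤ r) (h1 : r ≤ 1) : ∃ A : Set S, MeasurableSet A ∧ P.real A = r := by
  -- The endpoints are split off: the distribution function tends to 0 and 1 but need not attain
  -- them.
  rcases h0.eq_or_lt with rfl | h0
  · exact ⟨∅, MeasurableSet.empty, by simp⟩
  rcases h1.eq_or_lt with rfl | h1
  · exact ⟨univ, MeasurableSet.univ, by simp⟩
  have he := measurableEmbedding_embeddingReal S
  set ν := P.map (embeddingReal S) with hν
  have : IsProbabilityMeasure ν := Measure.isProbabilityMeasure_map he.measurable.aemeasurable
  have hatom : ∀ a : ℝ, ν {a} = 0 := fun a => by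
    rw [hν, he.map_apply]
    exact ((subsingleton_singleton (a := a)).preimage he.injective).measure_zero P
  -- The distribution function is right-continuous, and its jump at `a` is the mass of `{a}`, which
  -- is zero.
  have hcont : Continuous (cdf ν) := continuous_iff_continuousAt.2 fun a => by
    rw [(monotone_cdf ν).continuousAt_iff_leftLim_eq_rightLim, (cdf ν).rightLim_eq]
    have h := hatom a
    rw [← measure_cdf ν, StieltjesFunction.measure_singleton, ENNReal.ofReal_eq_zero] at h
    exact le_antisymm ((monotone_cdf ν).leftLim_le le_rfl) (by linarith)
  obtain ⟨a, ha⟩ := mem_range_of_exists_le_of_exists_ge hcont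
    (((tendsto_cdf_atBot ν).eventually (gt_mem_nhds h0)).exists.imp fun _ h => h.le)
    (((tendsto_cdf_atTop ν).eventually (lt_mem_nhds h1)).exists.imp fun _ h => h.le)
  refine ⟨embeddingReal S ⁻¹' Iic a, he.measurable measurableSet_Iic, ?_⟩
  rw [← ha, cdf_eq_real, measureReal_def, measureReal_def, hν, he.map_apply]

/-! ### Concavity along diagonals in terms of supporting tangents -/

/-- `G` lies below its tangents with gradient `(p, q)` along the diagonals of the strip. -/
def HasDiagonalSupergradient (ε : ℝ) (G p q : ℝ × ℝ → ℝ) : Prop :=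
  ∀ x ∈ strip ε, ∀ a d : ℝ, |a| = 1 → (x.1 + d, x.2 + a * d) ∈ strip ε →
    G (x.1 + d, x.2 + a * d) ≤ G x + (p x + a * q x) * d

theorem HasDiagonalSupergradient.add {ε : ℝ} {G p q G' p' q' : ℝ × ℝ → ℝ}
    (h : HasDiagonalSupergradient ε G p q) (h' : HasDiagonalSupergradient ε G' p' q') :
    HasDiagonalSupergradient ε (fun x => G x + G' x) (fun x => p x + p' x)
      (fun x => q x + q' x) := by
  intro x hx a d ha hy
  have h1 := h x hx a d ha hy
  have h2 := h' x hx a d ha hy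
  simp only
  linarith

theorem HasDiagonalSupergradient.const_mul {ε : ℝ} {G p q : ℝ × ℝ → ℝ}
    (h : HasDiagonalSupergradient ε G p q) {δ : ℝ} (hδ : 0 ≤ δ) :
    HasDiagonalSupergradient ε (fun x => δ * G x) (fun x => δ * p x) (fun x => δ * q x) := by
  intro x hx a d ha hy
  have h1 := mul_le_mul_of_nonneg_left (h x hx a d ha hy) hδ
  simp only
  linarith

theorem concaveOn_of_forall_exists_tangent {D : Set ℝ} (hD : Convex ℝ D) {g : ℝ → ℝ}
    (h : ∀ s ∈ D, ∃ k : ℝ, ∀ t ∈ D, g t ≤ g s + k * (t - s)) : ConcaveOn ℝ D g := by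
  refine ⟨hD, fun s hs t ht a b ha hb hab => ?_⟩
  obtain ⟨k, hk⟩ := h _ (hD hs ht ha hb hab)
  have h1 := mul_le_mul_of_nonneg_left (hk s hs) ha
  have h2 := mul_le_mul_of_nonneg_left (hk t ht) hb
  simp only [smul_eq_mul] at *
  have hb' : b = 1 - a := by linarith
  subst hb'
  nlinarith

theorem HasDiagonalSupergradient.concaveOn {ε : ℝ} {G p q : ℝ × ℝ → ℝ}
    (h : HasDiagonalSupergradient ε G p q) (y : ℝ × ℝ) {a : ℝ} (ha : |a| = 1) :
    ConcaveOn ℝ {t : ℝ | (y.1 + t, y.2 + a * t) ∈ strip ε}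
      (fun t => G (y.1 + t, y.2 + a * t)) := by
  refine concaveOn_of_forall_exists_tangent ?_ fun s hs => ⟨p (y.1 + s, y.2 + a * s) +
    a * q (y.1 + s, y.2 + a * s), fun t ht => ?_⟩
  · intro s hs t ht c d hc hd hcd
    simp only [strip, mem_ofPred_eq, smul_eq_mul] at *
    have hd' : d = 1 - c := by linarith
    subst hd'
    constructor <;> nlinarith
  · have := h _ hs a (t - s) ha
    simp only at this
    rw [show y.1 + s + (t - s) = y.1 + t by ring,
      show y.2 + a * s + a * (t - s) = y.2 + a * t by ring] at this
    exact this ht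

theorem HasDiagonalSupergradient.diagonallyConcaveOn {ε : ℝ} {G p q : ℝ × ℝ → ℝ}
    (h : HasDiagonalSupergradient ε G p q) : DiagonallyConcaveOn (strip ε) G := by
  intro y _
  have h1 := h.concaveOn y (a := 1) (by simp)
  have h2 := h.concaveOn y (a := -1) (by simp)
  simp only [one_mul, neg_one_mul, ← sub_eq_add_neg] at h1 h2
  exact ⟨h1, h2⟩

/-! ### Dense filtrations and supermartingale estimates for admissible pairs -/

section Filtration

open Filter Topology

variable {S : Type*} {m : MeasurableSpace S} {P : Measure S} {ℱ : Filtration ℕ m}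

/-- Up to null sets, a dense filtration generates the whole σ-algebra. -/
theorem IsDenseFiltration.exists_ae_eq [IsProbabilityMeasure P] (h : IsDenseFiltration P ℱ)
    {A : Set S} (hA : MeasurableSet A) : ∃ A', MeasurableSet[⨆ n, ℱ n] A' ∧ A' =ᵐ[P] A := by
  have hpos : ∀ k : ℕ, (0 : ENNReal) < 2⁻¹ ^ k := fun k =>
    pos_iff_ne_zero.2 (pow_ne_zero _ (by simp))
  -- The errors `2⁻ᵏ` are summable, so by Borel–Cantelli almost every point lies in only finitely
  -- many sets `A ∆ B k`, and `limsup B` agrees with `A` almost everywhere.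
  choose n B hB hAB using fun k : ℕ => h.dense A hA (2⁻¹ ^ k) (hpos k)
  refine ⟨limsup B atTop, @MeasurableSet.measurableSet_limsup S (⨆ n, ℱ n) B fun k =>
    le_iSup (fun n => ℱ n) (n k) _ (hB k), ?_⟩
  have hsum : ∑' k, P (symmDiff A (B k)) ≠ ⊤ := by
    refine ne_top_of_le_ne_top ?_ (ENNReal.tsum_le_tsum fun k => (hAB k).le)
    rw [ENNReal.tsum_geometric]
    simp
  filter_upwards [ae_eventually_notMem hsum] with s hs
  refine propext ?_
  change s ∈ limsup B atTop ↔ s ∈ A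
  rw [mem_limsup_iff_frequently_mem]
  have hs' : ∀ᶠ k in atTop, (s ∈ B k ↔ s ∈ A) := hs.mono fun k hk => by
    rw [mem_symmDiff] at hk
    tauto
  rw [frequently_congr hs']
  simp

theorem IsDenseFiltration.condExp_iSup [IsProbabilityMeasure P] (h : IsDenseFiltration P ℱ)
    {g : S → ℝ} (hg : Integrable g P) : P[g|⨆ n, ℱ n] =ᵐ[P] g := by
  have hle : ⨆ n, ℱ n ≤ m := iSup_le fun n => ℱ.le n
  refine Integrable.ae_eq_of_forall_setIntegral_eq _ _ integrable_condExp hg fun A hA _ => ?_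
  obtain ⟨A', hA', hAA'⟩ := h.exists_ae_eq hA
  rw [← setIntegral_congr_set hAA', ← setIntegral_congr_set hAA', setIntegral_condExp hle hg hA']

/-- Lévy's upward theorem gives the limit `𝔼(g ∣ ⨆ ℱ n)`, and density identifies it with `g`. -/
theorem IsDenseFiltration.tendsto_condExp [IsProbabilityMeasure P] (h : IsDenseFiltration P ℱ)
    {g : S → ℝ} (hg : Integrable g P) :
    ∀ᵐ s ∂P, Tendsto (fun n => (P[g|ℱ n]) s) atTop (𝓝 (g s)) := by
  filter_upwards [MeasureTheory.tendsto_ae_condExp (ℱ := ℱ) g, h.condExp_iSup hg] with s h1 h2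
  rwa [h2] at h1

theorem IsDenseFiltration.condExp_zero [IsProbabilityMeasure P] (h : IsDenseFiltration P ℱ)
    {g : S → ℝ} (hg : Integrable g P) : ∀ᵐ s ∂P, (P[g|ℱ 0]) s = ∫ s, g s ∂P := by
  refine (ae_eq_condExp_of_forall_setIntegral_eq (ℱ.le 0) hg
    (g := fun _ => ∫ s, g s ∂P) (fun _ _ _ => integrable_const _ |>.integrableOn) ?_
    stronglyMeasurable_const.aestronglyMeasurable).symm
  intro A hA _
  rcases h.zero_trivial A hA with h0 | h1
  · rw [setIntegral_measure_zero _ h0, setIntegral_measure_zero _ h0]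
  · have hA' : A =ᵐ[P] univ := by
      rw [ae_eq_univ, prob_compl_eq_zero_iff (ℱ.le 0 _ hA), h1]
    rw [setIntegral_congr_set hA', setIntegral_congr_set hA']
    simp

variable {ε : ℝ} {x : ℝ × ℝ} {φ ψ : S → ℝ}

theorem IsAdmissible.condExp_mem_strip (h : IsAdmissible P ℱ ε x φ ψ) (n : ℕ) :
    ∀ᵐ s ∂P, ((P[φ|ℱ n]) s, (P[ψ|ℱ n]) s) ∈ strip ε := by
  have := ae_bdd_abs_condExp_of_ae_bdd_abs (m := ℱ n)
    (h.abs_snd.mono fun s hs => hs.le)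
  filter_upwards [this] with s hs
  exact abs_le.1 hs

theorem stronglyMeasurable_comp_condExp {m' : MeasurableSpace S} {G : ℝ × ℝ → ℝ}
    (hG : Continuous G) : StronglyMeasurable[m'] fun s => G ((P[φ|m']) s, (P[ψ|m']) s) :=
  hG.comp_stronglyMeasurable (stronglyMeasurable_condExp.prodMk stronglyMeasurable_condExp)

theorem IsAdmissible.aestronglyMeasurable_comp (h : IsAdmissible P ℱ ε x φ ψ)
    {G : ℝ × ℝ → ℝ} (hG : Continuous G) :
    AEStronglyMeasurable (fun s => G (φ s, ψ s)) P :=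
  hG.comp_aestronglyMeasurable
    (h.integrable_fst.aestronglyMeasurable.prodMk h.integrable_snd.aestronglyMeasurable)

variable [IsProbabilityMeasure P]

/-- The increments of `φ_n` and `ψ_n` have equal absolute values, and `ψ_n` stays in `[-ε, ε]`.
Hence each `φ_n` is bounded even when `φ` is not, and continuous functions of the martingale are
integrable without any growth condition. -/
theorem IsAdmissible.abs_condExp_fst_sub_le (h : IsAdmissible P ℱ ε x φ ψ)
    (hF : IsDenseFiltration P ℱ) (n : ℕ) : ∀ᵐ s ∂P, |(P[φ|ℱ n]) s - x.1| ≤ 2 * ε * n := by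
  induction n with
  | zero =>
    filter_upwards [hF.condExp_zero h.integrable_fst] with s hs
    simp [hs, h.mean_fst]
  | succ n ih =>
    obtain ⟨α, hα⟩ := h.transform
    filter_upwards [ih, (hα n).2.1, (hα n).2.2, h.condExp_mem_strip n,
      h.condExp_mem_strip (n + 1)] with s h1 h2 h3 h4 h5
    have h6 : |(P[φ|ℱ (n + 1)]) s - (P[φ|ℱ n]) s| ≤ 2 * ε := by
      rw [← one_mul |_|, ← h2, ← abs_mul, ← h3, abs_le]
      simp only [strip, mem_ofPred_eq] at h4 h5
      constructor <;> linarith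
    push_cast
    rw [abs_le] at *
    constructor <;> linarith

/-- Continuous functions of the martingale are bounded at each step. -/
theorem IsAdmissible.exists_abs_comp_condExp_le (h : IsAdmissible P ℱ ε x φ ψ)
    (hF : IsDenseFiltration P ℱ) {G : ℝ × ℝ → ℝ} (hG : Continuous G) (n : ℕ) :
    ∃ C, ∀ᵐ s ∂P, |G ((P[φ|ℱ n]) s, (P[ψ|ℱ n]) s)| ≤ C := by
  obtain ⟨C, hC⟩ := (isCompact_Icc (a := x.1 - 2 * ε * n) (b := x.1 + 2 * ε * n)).prod
    (isCompact_Icc (a := -ε) (b := ε)) |>.exists_bound_of_continuousOn hG.continuousOn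
  refine ⟨C, ?_⟩
  filter_upwards [h.condExp_mem_strip n, h.abs_condExp_fst_sub_le hF n] with s h1 h2
  rw [abs_le] at h2
  exact hC _ ⟨⟨by linarith, by linarith⟩, h1⟩

theorem IsAdmissible.integrable_comp_condExp (h : IsAdmissible P ℱ ε x φ ψ)
    (hF : IsDenseFiltration P ℱ) {G : ℝ × ℝ → ℝ} (hG : Continuous G) (n : ℕ) :
    Integrable (fun s => G ((P[φ|ℱ n]) s, (P[ψ|ℱ n]) s)) P := by
  obtain ⟨C, hC⟩ := h.exists_abs_comp_condExp_le hF hG n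
  exact Integrable.of_bound
    ((stronglyMeasurable_comp_condExp hG).mono (ℱ.le n)).aestronglyMeasurable C hC

/-- Each jump goes along a diagonal, so the tangent inequality bounds `G` after the jump by `G`
before it plus a slope times the jump. The slope is known at time `n`, hence the last term has mean
zero. -/
theorem IsAdmissible.integral_comp_condExp_succ_le (h : IsAdmissible P ℱ ε x φ ψ)
    (hF : IsDenseFiltration P ℱ) {G p q : ℝ × ℝ → ℝ} (hG : Continuous G) (hp : Continuous p)
    (hq : Continuous q) (hGpq : HasDiagonalSupergradient ε G p q) (n : ℕ) :
    ∫ s, G ((P[φ|ℱ (n + 1)]) s, (P[ψ|ℱ (n + 1)]) s) ∂P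
      ≤ ∫ s, G ((P[φ|ℱ n]) s, (P[ψ|ℱ n]) s) ∂P := by
  obtain ⟨α, hα⟩ := h.transform
  obtain ⟨hα1, hα2, hα3⟩ := hα n
  set d : S → ℝ := P[φ|ℱ (n + 1)] - P[φ|ℱ n] with hd
  -- The slope `p + α q` is `ℱ n`-measurable because `α` is predictable; this lets it be pulled out
  -- of the conditional expectation.
  set l : S → ℝ := fun s => p ((P[φ|ℱ n]) s, (P[ψ|ℱ n]) s) +
    α n s * q ((P[φ|ℱ n]) s, (P[ψ|ℱ n]) s) with hl
  have hlm : StronglyMeasurable[ℱ n] l := (stronglyMeasurable_comp_condExp hp).add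
    (hα1.stronglyMeasurable.mul (stronglyMeasurable_comp_condExp hq))
  have hdi : Integrable d P := integrable_condExp.sub integrable_condExp
  obtain ⟨C, hC⟩ := h.exists_abs_comp_condExp_le hF hp n
  obtain ⟨C', hC'⟩ := h.exists_abs_comp_condExp_le hF hq n
  have hli : Integrable (l * d) P := by
    refine hdi.bdd_mul (c := C + C') (hlm.mono (ℱ.le n)).aestronglyMeasurable ?_
    filter_upwards [hC, hC', hα2] with s h1 h2 h3
    refine (abs_add_le _ _).trans ?_
    rw [abs_mul, h3, one_mul]
    exact add_le_add h1 h2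
  have hd0 : P[d|ℱ n] =ᵐ[P] 0 := by
    filter_upwards [condExp_sub integrable_condExp integrable_condExp (m := ℱ n)
      (f := P[φ|ℱ (n + 1)]) (g := P[φ|ℱ n]) (μ := P),
      condExp_condExp_of_le (f := φ) (μ := P) (ℱ.mono n.le_succ) (ℱ.le (n + 1)),
      condExp_condExp_of_le (f := φ) (μ := P) (le_refl (ℱ n)) (ℱ.le n)] with s h1 h2 h3
    rw [h1, Pi.sub_apply, h2, h3]
    simp
  have hint : ∫ s, (l * d) s ∂P = 0 := by
    rw [← integral_condExp (ℱ.le n), integral_eq_zero_of_ae]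
    filter_upwards [condExp_mul_of_stronglyMeasurable_left hlm hli hdi, hd0] with s h1 h2
    rw [h1, Pi.mul_apply, h2]
    simp
  have hGi := h.integrable_comp_condExp hF hG
  calc _ ≤ ∫ s, (G ((P[φ|ℱ n]) s, (P[ψ|ℱ n]) s) + (l * d) s) ∂P := by
        refine integral_mono_ae (hGi _) ((hGi n).add hli) ?_
        filter_upwards [hα2, hα3, h.condExp_mem_strip n, h.condExp_mem_strip (n + 1)]
          with s h2 h3 h4 h5
        have h6 : ((P[φ|ℱ (n + 1)]) s, (P[ψ|ℱ (n + 1)]) s) =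
            ((P[φ|ℱ n]) s + d s, (P[ψ|ℱ n]) s + α n s * d s) := by
          simp only [hd, Pi.sub_apply, ← h3]
          ext <;> simp
        rw [h6] at h5 ⊢
        exact hGpq _ h4 _ _ h2 h5
    _ = _ := by rw [integral_add (hGi n) hli, hint, add_zero]

theorem IsAdmissible.integral_comp_condExp_le (h : IsAdmissible P ℱ ε x φ ψ)
    (hF : IsDenseFiltration P ℱ) {G p q : ℝ × ℝ → ℝ} (hG : Continuous G) (hp : Continuous p)
    (hq : Continuous q) (hGpq : HasDiagonalSupergradient ε G p q) (n : ℕ) :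
    ∫ s, G ((P[φ|ℱ n]) s, (P[ψ|ℱ n]) s) ∂P ≤ G x := by
  induction n with
  | zero =>
    rw [integral_congr_ae (g := fun _ => G x)]
    · simp
    filter_upwards [hF.condExp_zero h.integrable_fst, hF.condExp_zero h.integrable_snd]
      with s h1 h2
    rw [h1, h2, h.mean_fst, h.mean_snd]
  | succ n ih => exact (h.integral_comp_condExp_succ_le hF hG hp hq hGpq n).trans ih

/-- A continuous function which lies below its diagonal tangents and is bounded below on the strip
majorizes the means of its values at admissible pairs. -/
theorem IsAdmissible.integral_comp_le (h : IsAdmissible P ℱ ε x φ ψ)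
    (hF : IsDenseFiltration P ℱ) {G p q : ℝ × ℝ → ℝ} (hG : Continuous G) (hp : Continuous p)
    (hq : Continuous q) (hGpq : HasDiagonalSupergradient ε G p q) {K : ℝ}
    (hK : ∀ y ∈ strip ε, -K ≤ G y) :
    Integrable (fun s => G (φ s, ψ s)) P ∧ ∫ s, G (φ s, ψ s) ∂P ≤ G x := by
  have hGi := h.integrable_comp_condExp hF hG
  have hGK : ∀ n, Integrable (fun s => G ((P[φ|ℱ n]) s, (P[ψ|ℱ n]) s) + K) P := fun n =>
    (hGi n).add (integrable_const K)
  have hnn : ∀ n, 0 ≤ᵐ[P] fun s => G ((P[φ|ℱ n]) s, (P[ψ|ℱ n]) s) + K := fun n => by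
    filter_upwards [h.condExp_mem_strip n] with s hs
    have := hK _ hs
    simp only [Pi.zero_apply]
    linarith
  have hle : ∀ n, ∫⁻ s, ENNReal.ofReal (G ((P[φ|ℱ n]) s, (P[ψ|ℱ n]) s) + K) ∂P
      ≤ ENNReal.ofReal (G x + K) := fun n => by
    rw [← ofReal_integral_eq_lintegral_ofReal (hGK n) (hnn n),
      integral_add (hGi n) (integrable_const K)]
    refine ENNReal.ofReal_le_ofReal ?_
    have := h.integral_comp_condExp_le hF hG hp hq hGpq n
    simpa
  -- Fatou's lemma for the nonnegative functions `G(φ_n, ψ_n) + K`; it yields integrability of the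
  -- limit as well as the inequality.
  have hfatou : ∫⁻ s, ENNReal.ofReal (G (φ s, ψ s) + K) ∂P ≤ ENNReal.ofReal (G x + K) := by
    calc _ ≤ ∫⁻ s, liminf (fun n => ENNReal.ofReal
            (G ((P[φ|ℱ n]) s, (P[ψ|ℱ n]) s) + K)) atTop ∂P := by
          refine lintegral_mono_ae ?_
          filter_upwards [hF.tendsto_condExp h.integrable_fst,
            hF.tendsto_condExp h.integrable_snd] with s h1 h2
          refine (Tendsto.liminf_eq ?_).ge
          exact ENNReal.tendsto_ofReal
            (((hG.tendsto _).comp (h1.prodMk_nhds h2)).add_const K)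
      _ ≤ liminf (fun n => ∫⁻ s, ENNReal.ofReal
            (G ((P[φ|ℱ n]) s, (P[ψ|ℱ n]) s) + K) ∂P) atTop :=
          lintegral_liminf_le' fun n =>
            (hGK n).aestronglyMeasurable.aemeasurable.ennreal_ofReal
      _ ≤ _ := by
          refine (liminf_le_liminf (Eventually.of_forall hle)).trans ?_
          simp
  have hnn' : 0 ≤ᵐ[P] fun s => G (φ s, ψ s) + K := by
    filter_upwards [h.abs_snd] with s hs
    have := hK (φ s, ψ s) (abs_le.1 hs.le)
    simp only [Pi.zero_apply]
    linarith
  have hm : AEStronglyMeasurable (fun s => G (φ s, ψ s) + K) P :=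
    h.aestronglyMeasurable_comp (hG.add continuous_const)
  have hi : Integrable (fun s => G (φ s, ψ s) + K) P :=
    (lintegral_ofReal_ne_top_iff_integrable hm hnn').1
      (ne_top_of_le_ne_top ENNReal.ofReal_ne_top hfatou)
  have hi' : Integrable (fun s => G (φ s, ψ s)) P := by
    simpa [Pi.sub_def] using hi.sub (integrable_const K)
  refine ⟨hi', ?_⟩
  rw [← ofReal_integral_eq_lintegral_ofReal hi hnn', integral_add hi' (integrable_const K)]
    at hfatou
  -- `ENNReal.ofReal` truncates negative numbers, so the sign of the right-hand side is needed to
  -- return to the reals.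
  have hx : 0 ≤ G x + K := by
    have h0 := integral_nonneg_of_ae (hnn 0)
    rw [integral_add (hGi 0) (integrable_const K)] at h0
    have := h.integral_comp_condExp_le hF hG hp hq hGpq 0
    simp at h0
    linarith
  have := (ENNReal.ofReal_le_ofReal_iff hx).1 hfatou
  simpa using this

end Filtration

/-! ### Growth and Taylor estimates on the line -/

/-- Each integration raises the growth exponent by one; three applications turn a bounded third
derivative into cubic growth. -/
theorem exists_abs_le_of_abs_deriv_le {f f' : ℝ → ℝ} (hf : ∀ t, HasDerivAt f (f' t) t) {A : ℝ}
    {k : ℕ} (h : ∀ t, |f' t| ≤ A * (1 + |t|) ^ k) : ∃ B, ∀ t, |f t| ≤ B * (1 + |t|) ^ (k + 1) := by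
  have hA : 0 ≤ A := by simpa using (abs_nonneg _).trans (h 0)
  refine ⟨|f 0| + A, fun t => ?_⟩
  have h1 := (convex_Icc (-|t|) |t|).norm_image_sub_le_of_norm_hasDerivWithin_le
    (f := f) (f' := f') (C := A * (1 + |t|) ^ k) (x := 0) (y := t)
    (fun s _ => (hf s).hasDerivWithinAt)
    (fun s hs => (h s).trans (by
      have : |s| ≤ |t| := abs_le.2 hs
      gcongr)) (by simp) ⟨neg_abs_le t, le_abs_self t⟩
  rw [sub_zero, Real.norm_eq_abs, Real.norm_eq_abs] at h1
  have h2 : (1 : ℝ) ≤ (1 + |t|) ^ (k + 1) := one_le_pow₀ (by linarith [abs_nonneg t])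
  have h3 : A * (1 + |t|) ^ k * |t| ≤ A * (1 + |t|) ^ (k + 1) := by
    rw [pow_succ, ← mul_assoc]
    gcongr
    linarith
  have h4 : |f t| ≤ |f 0| + |f t - f 0| := by
    have := abs_add_le (f 0) (f t - f 0)
    simpa using this
  nlinarith [abs_nonneg (f 0)]

/-- Two applications of the mean value inequality. The constant `M` in place of `M / 2` only affects
how thin the strip must be. -/
theorem abs_sub_sub_mul_le {g g' g'' : ℝ → ℝ} (hg : ∀ t, HasDerivAt g (g' t) t)
    (hg' : ∀ t, HasDerivAt g' (g'' t) t) {M : ℝ} (h : ∀ t, |g'' t| ≤ M) (a b : ℝ) :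
    |g b - g a - g' a * (b - a)| ≤ M * (b - a) ^ 2 := by
  have h1 : ∀ s, |g' s - g' a| ≤ M * |s - a| := fun s =>
    convex_univ.norm_image_sub_le_of_norm_hasDerivWithin_le
      (fun s _ => (hg' s).hasDerivWithinAt) (fun s _ => h s) (mem_univ a) (mem_univ s)
  have hM : 0 ≤ M := (abs_nonneg _).trans (h 0)
  have h2 := (convex_uIcc a b).norm_image_sub_le_of_norm_hasDerivWithin_le
    (f := fun t => g t - g' a * (t - a)) (f' := fun t => g' t - g' a) (C := M * |b - a|)
    (fun s _ => by
      have := (hg s).sub (((hasDerivAt_id s).sub_const a).const_mul (g' a))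
      rw [mul_one] at this
      exact this.hasDerivWithinAt)
    (fun s hs => (h1 s).trans (by
      have := abs_sub_left_of_mem_uIcc hs
      gcongr)) left_mem_uIcc right_mem_uIcc
  simp only [Real.norm_eq_abs, sub_self, mul_zero, sub_zero] at h2
  rw [mul_assoc, abs_mul_abs_self, ← pow_two] at h2
  convert h2 using 2
  ring

theorem le_add_mul_sub_of_hasDerivAt_nonpos {D : Set ℝ} (hD : Convex ℝ D) {g g' g'' : ℝ → ℝ}
    (hg : ∀ t, HasDerivAt g (g' t) t) (hg' : ∀ t, HasDerivAt g' (g'' t) t)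
    (h : ∀ t ∈ D, g'' t ≤ 0) {s t : ℝ} (hs : s ∈ D) (ht : t ∈ D) :
    g t ≤ g s + g' s * (t - s) := by
  have hanti : AntitoneOn g' D := antitoneOn_of_hasDerivWithinAt_nonpos hD
    (fun u _ => (hg' u).continuousAt.continuousWithinAt)
    (fun u _ => (hg' u).hasDerivWithinAt) fun u hu => h u (interior_subset hu)
  rcases lt_trichotomy s t with hst | rfl | hst
  · obtain ⟨c, hc, hc'⟩ := exists_hasDerivAt_eq_slope g g' hst
      (fun u _ => (hg u).continuousAt.continuousWithinAt) fun u _ => hg u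
    have := hanti hs (hD.ordConnected.out hs ht (Ioo_subset_Icc_self hc)) hc.1.le
    rw [hc', div_le_iff₀ (by linarith)] at this
    linarith
  · simp
  · obtain ⟨c, hc, hc'⟩ := exists_hasDerivAt_eq_slope g g' hst
      (fun u _ => (hg u).continuousAt.continuousWithinAt) fun u _ => hg u
    have := hanti (hD.ordConnected.out ht hs (Ioo_subset_Icc_self hc)) hs hc.2.le
    rw [hc', le_div_iff₀ (by linarith)] at this
    linarith

theorem ContDiff.hasDerivAt_of_three {f : ℝ → ℝ} (hf : ContDiff ℝ 3 f) :
    (∀ t, HasDerivAt f (deriv f t) t) ∧ (∀ t, HasDerivAt (deriv f) (deriv (deriv f) t) t) ∧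
      (∀ t, HasDerivAt (deriv (deriv f)) (iteratedDeriv 3 f t) t) := by
  have h0 : ContDiff ℝ (2 + 1) f := hf
  have h1 : ContDiff ℝ (1 + 1) (deriv f) := (contDiff_succ_iff_deriv.1 h0).2.2
  have h2 : ContDiff ℝ (0 + 1) (deriv (deriv f)) := (contDiff_succ_iff_deriv.1 h1).2.2
  refine ⟨fun t => ((contDiff_succ_iff_deriv.1 h0).1 t).hasDerivAt,
    fun t => ((contDiff_succ_iff_deriv.1 h1).1 t).hasDerivAt, fun t => ?_⟩
  rw [iteratedDeriv_succ, iteratedDeriv_succ, iteratedDeriv_one]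
  exact ((contDiff_succ_iff_deriv.1 h2).1 t).hasDerivAt

/-- A `C³` function with bounded third derivative is `o(t⁴)` at infinity. -/
theorem ContDiff.exists_abs_le_mul_pow_four_add {f : ℝ → ℝ} (hf : ContDiff ℝ 3 f) {M : ℝ}
    (hM : ∀ t, |iteratedDeriv 3 f t| ≤ M) {δ : ℝ} (hδ : 0 < δ) :
    ∃ K, ∀ t, |f t| ≤ δ * t ^ 4 + K := by
  obtain ⟨h1, h2, h3⟩ := hf.hasDerivAt_of_three
  obtain ⟨A, hA⟩ := exists_abs_le_of_abs_deriv_le h3 (A := M) (k := 0) (by simpa using hM)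
  obtain ⟨B, hB⟩ := exists_abs_le_of_abs_deriv_le h2 hA
  obtain ⟨C, hC⟩ := exists_abs_le_of_abs_deriv_le h1 hB
  have hC0 : 0 ≤ C := by simpa using (abs_nonneg _).trans (hC 0)
  -- The threshold is `r = 8 C / δ + 1`. Above it `r ≥ 1` and `8 C ≤ δ r`, so `C (1 + r)³ ≤ 8 C r³ ≤
  -- δ r⁴`; below it `1 + r` is at most twice the threshold.
  refine ⟨δ + C * (8 * C / δ + 1) ^ 3 * 8, fun t => (hC t).trans ?_⟩
  set r := |t| with hr
  have hr0 : 0 ≤ r := abs_nonneg t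
  have ht : t ^ 4 = r ^ 4 := by rw [hr, show 4 = 2 * 2 by rfl, pow_mul, pow_mul, sq_abs]
  rw [ht]
  have hq : 0 ≤ 8 * C / δ := by positivity
  rcases le_total r (8 * C / δ + 1) with h | h
  · have : (1 + r) ^ 3 ≤ ((8 * C / δ + 1) * 2) ^ 3 := by
      gcongr
      linarith
    have := mul_le_mul_of_nonneg_left this hC0
    have : 0 ≤ δ * r ^ 4 := by positivity
    nlinarith
  · have h8 : 8 * C ≤ δ * r := by
      have : 8 * C / δ ≤ r := by linarith
      rwa [div_le_iff₀ hδ, mul_comm r] at this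
    have : (1 + r) ^ 3 ≤ (2 * r) ^ 3 := by
      gcongr
      linarith
    have h9 := mul_le_mul_of_nonneg_left this hC0
    have h10 := mul_le_mul_of_nonneg_right h8 (pow_nonneg hr0 3)
    have : 0 ≤ C * (8 * C / δ + 1) ^ 3 * 8 := by positivity
    nlinarith

/-! ### The foliated candidate and its diagonal concavity -/

/-- The function on the strip that interpolates the boundary values linearly along the segments
`x₁ - σ x₂ = const`. -/
noncomputable def foliationCandidate (σ ε : ℝ) (fp fm : ℝ → ℝ) (x : ℝ × ℝ) : ℝ :=
  ((ε - x.2) * fm (x.1 - σ * x.2 - σ * ε) + (ε + x.2) * fp (x.1 - σ * x.2 + σ * ε)) / (2 * ε)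

/-- The partial derivative of the candidate in `x₁`. -/
noncomputable def foliationCandidateFst (σ ε : ℝ) (fp fm : ℝ → ℝ) (x : ℝ × ℝ) : ℝ :=
  foliationCandidate σ ε (deriv fp) (deriv fm) x

/-- The partial derivative in `x₂`: the first term differentiates the weights, the second the
argument `x₁ - σ x₂`. -/
noncomputable def foliationCandidateSnd (σ ε : ℝ) (fp fm : ℝ → ℝ) (x : ℝ × ℝ) : ℝ :=
  (fp (x.1 - σ * x.2 + σ * ε) - fm (x.1 - σ * x.2 - σ * ε)) / (2 * ε)
    - σ * foliationCandidate σ ε (deriv fp) (deriv fm) x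

theorem continuous_foliationCandidate {σ ε : ℝ} {fp fm : ℝ → ℝ} (hfp : Continuous fp)
    (hfm : Continuous fm) : Continuous (foliationCandidate σ ε fp fm) := by
  unfold foliationCandidate
  fun_prop

theorem continuous_foliationCandidateSnd {σ ε : ℝ} {fp fm : ℝ → ℝ} (hfp : ContDiff ℝ 3 fp)
    (hfm : ContDiff ℝ 3 fm) : Continuous (foliationCandidateSnd σ ε fp fm) := by
  have h1 := hfp.continuous
  have h2 := hfm.continuous
  have h3 := continuous_foliationCandidate (σ := σ) (ε := ε)
    (hfp.continuous_deriv (by norm_num)) (hfm.continuous_deriv (by norm_num))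
  unfold foliationCandidateSnd
  fun_prop

theorem boundaryValue_eq_foliationCandidate {ε : ℝ} (σ : ℝ) (hε : 0 < ε) (fp fm : ℝ → ℝ)
    {x : ℝ × ℝ} (hx : |x.2| = ε) :
    boundaryValue ε fp fm x = foliationCandidate σ ε fp fm x := by
  rcases (abs_eq hε.le).1 hx with h | h
  · simp only [boundaryValue, foliationCandidate, h, if_true]
    rw [show x.1 - σ * ε + σ * ε = x.1 by ring]
    field_simp
    ring
  · have hne : -ε ≠ ε := by linarith
    simp only [boundaryValue, foliationCandidate, h, if_true, if_neg hne]
    rw [show x.1 - σ * -ε - σ * ε = x.1 by ring]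
    field_simp
    ring

/-- The candidate is concave across its foliation when the strip is thin. -/
theorem foliationCandidate_curvature_le {σ ε c M : ℝ} {fp fm : ℝ → ℝ} (hσ : σ * σ = 1)
    (hfp : ContDiff ℝ 3 fp) (hfm : ContDiff ℝ 3 fm) (hMp : ∀ t, |iteratedDeriv 3 fp t| ≤ M)
    (hMm : ∀ t, |iteratedDeriv 3 fm t| ≤ M) (hc : ∀ t, c ≤ σ * (deriv fp t - deriv fm t))
    (hε : 4 * M * ε ^ 2 ≤ c) (u : ℝ) {t : ℝ} (ht : |t| ≤ ε) :
    (ε - t) * deriv (deriv fm) (u - σ * ε) + (ε + t) * deriv (deriv fp) (u + σ * ε)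
      ≤ σ * (deriv fp (u + σ * ε) - deriv fm (u - σ * ε)) := by
  obtain ⟨-, hp1, hp2⟩ := hfp.hasDerivAt_of_three
  obtain ⟨-, hm1, hm2⟩ := hfm.hasDerivAt_of_three
  have hM : 0 ≤ M := (abs_nonneg _).trans (hMp 0)
  -- Both derivatives are expanded to the common point `u - σ t`, where the first-order terms cancel
  -- the second derivatives in the claim. What remains is `σ (f₊' - f₋')(u - σ t) ≥ c`, with total
  -- error at most `M ((ε + t)² + (ε - t)²) ≤ 4 M ε²`.
  have h1 := abs_sub_sub_mul_le hp1 hp2 hMp (u + σ * ε) (u - σ * t)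
  have h2 := abs_sub_sub_mul_le hm1 hm2 hMm (u - σ * ε) (u - σ * t)
  have h3 := hc (u - σ * t)
  have hsq1 : (u - σ * t - (u + σ * ε)) ^ 2 = (ε + t) ^ 2 := by linear_combination (ε + t) ^ 2 * hσ
  have hsq2 : (u - σ * t - (u - σ * ε)) ^ 2 = (ε - t) ^ 2 := by linear_combination (ε - t) ^ 2 * hσ
  rw [hsq1] at h1
  rw [hsq2] at h2
  have hσ' : |σ| = 1 := by
    rcases mul_self_eq_one_iff.1 hσ with rfl | rfl <;> simp
  rw [← one_mul |_|, ← hσ', ← abs_mul, abs_le] at h1 h2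
  have ht2 : t ^ 2 ≤ ε ^ 2 := sq_le_sq' (by linarith [(abs_le.1 ht).1]) (abs_le.1 ht).2
  have hMt := mul_le_mul_of_nonneg_left ht2 hM
  have e1 : σ * (deriv fp (u - σ * t) - deriv fp (u + σ * ε) -
      deriv (deriv fp) (u + σ * ε) * (u - σ * t - (u + σ * ε)))
      = σ * deriv fp (u - σ * t) - σ * deriv fp (u + σ * ε) +
        (ε + t) * deriv (deriv fp) (u + σ * ε) := by
    linear_combination (deriv (deriv fp) (u + σ * ε) * (ε + t)) * hσ
  have e2 : σ * (deriv fm (u - σ * t) - deriv fm (u - σ * ε) -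
      deriv (deriv fm) (u - σ * ε) * (u - σ * t - (u - σ * ε)))
      = σ * deriv fm (u - σ * t) - σ * deriv fm (u - σ * ε) -
        (ε - t) * deriv (deriv fm) (u - σ * ε) := by
    linear_combination -(deriv (deriv fm) (u - σ * ε) * (ε - t)) * hσ
  rw [e1] at h1
  rw [e2] at h2
  nlinarith [h1.2, h2.1]

theorem convex_setOf_abs_add_mul_le (y a ε : ℝ) : Convex ℝ {d : ℝ | |y + a * d| ≤ ε} := by
  intro s hs t ht b c hb hc hbc
  simp only [mem_ofPred_eq, smul_eq_mul, abs_le] at *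
  have hc' : c = 1 - b := by linarith
  subst hc'
  constructor <;> nlinarith

/-- In direction `a = σ` the candidate is affine and equality holds. In direction `a = -σ` the
curvature estimate makes its second derivative nonpositive. -/
theorem hasDiagonalSupergradient_foliationCandidate {σ ε c M : ℝ} {fp fm : ℝ → ℝ}
    (hσ : σ * σ = 1) (hε0 : 0 < ε)
    (hfp : ContDiff ℝ 3 fp) (hfm : ContDiff ℝ 3 fm) (hMp : ∀ t, |iteratedDeriv 3 fp t| ≤ M)
    (hMm : ∀ t, |iteratedDeriv 3 fm t| ≤ M) (hc : ∀ t, c ≤ σ * (deriv fp t - deriv fm t))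
    (hε : 4 * M * ε ^ 2 ≤ c) :
    HasDiagonalSupergradient ε (foliationCandidate σ ε fp fm) (foliationCandidateFst σ ε fp fm)
      (foliationCandidateSnd σ ε fp fm) := by
  intro x hx a d ha hy
  have haσ : a = σ ∨ a = -σ := by
    rw [← sq_eq_sq_iff_eq_or_eq_neg, ← sq_abs, ha, one_pow, sq, hσ]
  rcases haσ with rfl | rfl
  · have h1 : x.1 + d - a * (x.2 + a * d) = x.1 - a * x.2 := by linear_combination -d * hσ
    simp only [foliationCandidate, foliationCandidateFst, foliationCandidateSnd, h1]
    refine le_of_eq ?_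
    generalize fm _ = m₀, fp _ = p₀, deriv fm _ = m₁, deriv fp _ = p₁
    field_simp
    linear_combination (d * ((ε - x.2) * m₁ + (ε + x.2) * p₁)) * hσ
  · obtain ⟨hp0, hp1, -⟩ := hfp.hasDerivAt_of_three
    obtain ⟨hm0, hm1, -⟩ := hfm.hasDerivAt_of_three
    -- Along this diagonal `x₁ - σ x₂` moves with speed 2 and `x₂` with speed `-σ`.
    set u := x.1 - σ * x.2 with hu
    have hY : ∀ t : ℝ, HasDerivAt (fun t => x.2 + -σ * t) (-σ) t := fun t => by
      simpa using ((hasDerivAt_id t).const_mul (-σ)).const_add x.2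
    have hU : ∀ b t : ℝ, HasDerivAt (fun t => u + 2 * t + b) 2 t := fun b t => by
      simpa using (((hasDerivAt_id t).const_mul 2).const_add u).add_const b
    have key : ∀ {f f' : ℝ → ℝ} (b t : ℝ), (∀ t, HasDerivAt f (f' t) t) →
        HasDerivAt (fun t => f (u + 2 * t + b)) (f' (u + 2 * t + b) * 2) t :=
      fun {f f'} b t hf => HasDerivAt.comp t (hf _) (hU b t)
    have g1 : ∀ t, HasDerivAt (fun t => ((ε - (x.2 + -σ * t)) * fm (u + 2 * t + -(σ * ε)) +
        (ε + (x.2 + -σ * t)) * fp (u + 2 * t + σ * ε)) / (2 * ε))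
        ((-(-σ) * fm (u + 2 * t + -(σ * ε)) +
          (ε - (x.2 + -σ * t)) * (deriv fm (u + 2 * t + -(σ * ε)) * 2) +
          (-σ * fp (u + 2 * t + σ * ε) +
          (ε + (x.2 + -σ * t)) * (deriv fp (u + 2 * t + σ * ε) * 2))) / (2 * ε)) t := fun t =>
      ((((hY t).const_sub ε).mul (key _ t hm0)).add
        (((hY t).const_add ε).mul (key _ t hp0))).div_const _
    have g2 : ∀ t, HasDerivAt (fun t => (-(-σ) * fm (u + 2 * t + -(σ * ε)) +
          (ε - (x.2 + -σ * t)) * (deriv fm (u + 2 * t + -(σ * ε)) * 2) +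
          (-σ * fp (u + 2 * t + σ * ε) +
          (ε + (x.2 + -σ * t)) * (deriv fp (u + 2 * t + σ * ε) * 2))) / (2 * ε))
        ((-(-σ) * (deriv fm (u + 2 * t + -(σ * ε)) * 2) +
          (-(-σ) * (deriv fm (u + 2 * t + -(σ * ε)) * 2) +
          (ε - (x.2 + -σ * t)) * (deriv (deriv fm) (u + 2 * t + -(σ * ε)) * 2 * 2)) +
          (-σ * (deriv fp (u + 2 * t + σ * ε) * 2) +
          (-σ * (deriv fp (u + 2 * t + σ * ε) * 2) +
          (ε + (x.2 + -σ * t)) * (deriv (deriv fp) (u + 2 * t + σ * ε) * 2 * 2)))) / (2 * ε)) t :=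
      fun t => ((((key _ t hm0).const_mul _).add
        (((hY t).const_sub ε).mul ((key _ t hm1).mul_const 2))).add
        (((key _ t hp0).const_mul _).add
        (((hY t).const_add ε).mul ((key _ t hp1).mul_const 2)))).div_const _
    have h := le_add_mul_sub_of_hasDerivAt_nonpos (convex_setOf_abs_add_mul_le x.2 (-σ) ε) g1 g2
      (fun t ht => ?_) (s := 0) (t := d) (by simpa using abs_le.2 hx) (abs_le.2 hy)
    · have h1 : x.1 + d - σ * (x.2 + -σ * d) = u + 2 * d := by linear_combination d * hσ
      simp only [foliationCandidate, foliationCandidateFst, foliationCandidateSnd, h1]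
      simp only [mul_zero, add_zero, sub_zero, ← sub_eq_add_neg (_ : ℝ) (σ * ε)] at h
      refine h.trans_eq ?_
      rw [← hu]
      generalize fm _ = m₀, fp _ = p₀, deriv fm _ = m₁, deriv fp _ = p₁
      field_simp
      linear_combination (-d * ((ε - x.2) * m₁ + (ε + x.2) * p₁)) * hσ
    · refine div_nonpos_of_nonpos_of_nonneg ?_ (by positivity)
      have := foliationCandidate_curvature_le hσ hfp hfm hMp hMm hc hε (u + 2 * t) ht
      rw [sub_eq_add_neg (u + 2 * t)] at this
      linarith

/-! ### The quartic correction that restores a lower bound -/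

/-- A diagonally concave majorant of `x₁ ^ 4` on the strip. -/
noncomputable def quarticMajorant (ε : ℝ) (x : ℝ × ℝ) : ℝ :=
  x.1 ^ 4 + 12 * x.1 ^ 2 * (ε ^ 2 - x.2 ^ 2) + 108 * ε ^ 2 * (ε ^ 2 - x.2 ^ 2)

theorem pow_four_le_quarticMajorant {ε : ℝ} {x : ℝ × ℝ} (hx : x ∈ strip ε) :
    x.1 ^ 4 ≤ quarticMajorant ε x := by
  have h : 0 ≤ ε ^ 2 - x.2 ^ 2 := by
    have := sq_le_sq' hx.1 hx.2
    linarith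
  have h1 : 0 ≤ 12 * x.1 ^ 2 * (ε ^ 2 - x.2 ^ 2) := by positivity
  have h2 : 0 ≤ 108 * ε ^ 2 * (ε ^ 2 - x.2 ^ 2) := by positivity
  unfold quarticMajorant
  linarith

theorem hasDiagonalSupergradient_quarticMajorant (ε : ℝ) :
    HasDiagonalSupergradient ε (quarticMajorant ε)
      (fun x => 4 * x.1 ^ 3 + 24 * x.1 * (ε ^ 2 - x.2 ^ 2))
      (fun x => -(24 * x.1 ^ 2 * x.2) - 216 * ε ^ 2 * x.2) := by
  intro x hx a d ha hy
  have ha2 : a ^ 2 = 1 := by rw [← sq_abs, ha, one_pow]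
  have hX : ∀ t : ℝ, HasDerivAt (fun t => x.1 + t) 1 t := fun t => (hasDerivAt_id t).const_add _
  have hY : ∀ t : ℝ, HasDerivAt (fun t => x.2 + a * t) a t := fun t => by
    simpa using ((hasDerivAt_id t).const_mul a).const_add x.2
  have hZ : ∀ t : ℝ, HasDerivAt (fun t => ε ^ 2 - (x.2 + a * t) ^ 2) (-(2 * (x.2 + a * t) * a)) t :=
    fun t => by simpa using ((hY t).pow 2).const_sub (ε ^ 2)
  have g1 : ∀ t, HasDerivAt (fun t => quarticMajorant ε (x.1 + t, x.2 + a * t))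
      (4 * (x.1 + t) ^ 3 + 24 * (x.1 + t) * (ε ^ 2 - (x.2 + a * t) ^ 2)
        - 24 * a * ((x.1 + t) ^ 2 * (x.2 + a * t)) - 216 * ε ^ 2 * a * (x.2 + a * t)) t := fun t => by
    have := ((((hX t).pow 4)).add ((((hX t).pow 2).const_mul 12).mul (hZ t))).add
      ((hZ t).const_mul (108 * ε ^ 2))
    refine HasDerivAt.congr_deriv this ?_
    simp
    ring
  have g2 : ∀ t, HasDerivAt (fun t => 4 * (x.1 + t) ^ 3
        + 24 * (x.1 + t) * (ε ^ 2 - (x.2 + a * t) ^ 2)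
        - 24 * a * ((x.1 + t) ^ 2 * (x.2 + a * t)) - 216 * ε ^ 2 * a * (x.2 + a * t))
      (12 * (x.1 + t) ^ 2 + 24 * (ε ^ 2 - (x.2 + a * t) ^ 2) - 96 * a * (x.1 + t) * (x.2 + a * t)
        - 24 * a ^ 2 * (x.1 + t) ^ 2 - 216 * ε ^ 2 * a ^ 2) t := fun t => by
    have := (((((hX t).pow 3).const_mul 4).add (((hX t).const_mul 24).mul (hZ t))).sub
      ((((hX t).pow 2).mul (hY t)).const_mul (24 * a))).sub ((hY t).const_mul (216 * ε ^ 2 * a))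
    refine HasDerivAt.congr_deriv this ?_
    simp
    ring
  have h := le_add_mul_sub_of_hasDerivAt_nonpos (convex_setOf_abs_add_mul_le x.2 a ε) g1 g2
    (fun t ht => ?_) (s := 0) (t := d) (by simpa using abs_le.2 hx) (abs_le.2 hy)
  · simp only [mul_zero, add_zero, sub_zero] at h
    refine h.trans_eq ?_
    simp only
    ring
  · have h1 : (x.2 + a * t) ^ 2 ≤ ε ^ 2 := sq_le_sq' (abs_le.1 ht).1 (abs_le.1 ht).2
    rw [ha2]
    have h2 : (a * (x.2 + a * t)) ^ 2 = (x.2 + a * t) ^ 2 := by rw [mul_pow, ha2, one_mul]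
    -- With `X = x₁ + t` and `Y = x₂ + a t`, the second derivative equals `-12 (X + 4 a Y)² + 168 Y²
    -- - 192 ε²`.
    nlinarith [sq_nonneg (x.1 + t + 4 * (a * (x.2 + a * t)))]

theorem exists_neg_le_foliationCandidate_add {σ ε M : ℝ} {fp fm : ℝ → ℝ} (hσ : σ * σ = 1)
    (hε : 0 < ε) (hfp : ContDiff ℝ 3 fp) (hfm : ContDiff ℝ 3 fm)
    (hMp : ∀ t, |iteratedDeriv 3 fp t| ≤ M) (hMm : ∀ t, |iteratedDeriv 3 fm t| ≤ M)
    {δ : ℝ} (hδ : 0 < δ) : ∃ K, ∀ x ∈ strip ε,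
      -K ≤ foliationCandidate σ ε fp fm x + δ * quarticMajorant ε x := by
  -- The candidate averages values of `f_±` at points within `2 ε` of `x₁`; the factor 8 comes from
  -- `(a + b)⁴ ≤ 8 (a⁴ + b⁴)`.
  have hδ8 : 0 < δ / 8 := by positivity
  obtain ⟨K, hK⟩ := hfp.exists_abs_le_mul_pow_four_add hMp hδ8
  obtain ⟨K', hK'⟩ := hfm.exists_abs_le_mul_pow_four_add hMm hδ8
  refine ⟨δ * (2 * ε) ^ 4 + max K K', fun x hx => ?_⟩
  have hquart : ∀ r : ℝ, |r| ≤ 2 * ε → δ / 8 * (x.1 + r) ^ 4 ≤ δ * (x.1 ^ 4 + (2 * ε) ^ 4) := by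
    intro r hr
    have h1 : r ^ 4 ≤ (2 * ε) ^ 4 := by
      rw [← Even.pow_abs (by decide)]
      gcongr
    have h2 : (x.1 + r) ^ 4 ≤ 8 * (x.1 ^ 4 + r ^ 4) := by
      nlinarith [sq_nonneg (x.1 - r), sq_nonneg (x.1 + r), sq_nonneg (x.1 ^ 2 - r ^ 2),
        mul_nonneg (sq_nonneg (x.1 - r)) (sq_nonneg (x.1 + r)),
        mul_nonneg (sq_nonneg (x.1 - r)) (sq_nonneg x.1),
        mul_nonneg (sq_nonneg (x.1 - r)) (sq_nonneg r), sq_nonneg ((x.1 - r) ^ 2)]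
    have := mul_le_mul_of_nonneg_left (h2.trans (by linarith : _ ≤ 8 * (x.1 ^ 4 + (2 * ε) ^ 4)))
      hδ8.le
    linarith
  have hσ' : σ = 1 ∨ σ = -1 := mul_self_eq_one_iff.1 hσ
  have hp := hquart (-σ * x.2 + σ * ε) (by
    rw [abs_le]
    rcases hσ' with rfl | rfl <;> constructor <;> linarith [hx.1, hx.2])
  have hm := hquart (-σ * x.2 - σ * ε) (by
    rw [abs_le]
    rcases hσ' with rfl | rfl <;> constructor <;> linarith [hx.1, hx.2])
  rw [show x.1 + (-σ * x.2 + σ * ε) = x.1 - σ * x.2 + σ * ε by ring] at hp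
  rw [show x.1 + (-σ * x.2 - σ * ε) = x.1 - σ * x.2 - σ * ε by ring] at hm
  set L := δ * (x.1 ^ 4 + (2 * ε) ^ 4) + max K K' with hL
  have hfp' : -L ≤ fp (x.1 - σ * x.2 + σ * ε) := by
    have := (abs_le.1 (hK (x.1 - σ * x.2 + σ * ε))).1
    linarith [le_max_left K K']
  have hfm' : -L ≤ fm (x.1 - σ * x.2 - σ * ε) := by
    have := (abs_le.1 (hK' (x.1 - σ * x.2 - σ * ε))).1
    linarith [le_max_right K K']
  have hB : -L ≤ foliationCandidate σ ε fp fm x := by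
    rw [foliationCandidate, le_div_iff₀ (by positivity)]
    have h1 := mul_le_mul_of_nonneg_left hfp' (by linarith [hx.1] : 0 ≤ ε + x.2)
    have h2 := mul_le_mul_of_nonneg_left hfm' (by linarith [hx.2] : 0 ≤ ε - x.2)
    linarith
  have := mul_le_mul_of_nonneg_left (pow_four_le_quarticMajorant hx) hδ.le
  linarith

theorem foliationCandidate_segment (σ ε : ℝ) (fp fm : ℝ → ℝ) {x : ℝ × ℝ} {u : ℝ} (hε : 0 < ε)
    (hx : x.1 - σ * x.2 = u) : foliationCandidate σ ε fp fm x =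
      (fp (u + σ * ε) + fm (u - σ * ε)) / 2 + 0 * x.1
        + (fp (u + σ * ε) - fm (u - σ * ε)) / (2 * ε) * x.2 := by
  rw [foliationCandidate, hx]
  field_simp
  ring

/-! ### Identification of the Bellman function with the candidate -/

section Bellman

variable {S : Type*} {m : MeasurableSpace S} {P : Measure S} [IsProbabilityMeasure P]
  {ℱ : Filtration ℕ m} {σ ε c M : ℝ} {fp fm : ℝ → ℝ}

theorem IsAdmissible.integral_boundaryValue_le {x : ℝ × ℝ} {φ ψ : S → ℝ}
    (h : IsAdmissible P ℱ ε x φ ψ) (hF : IsDenseFiltration P ℱ) (hσ : σ * σ = 1) (hε0 : 0 < ε)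
    (hfp : ContDiff ℝ 3 fp) (hfm : ContDiff ℝ 3 fm) (hMp : ∀ t, |iteratedDeriv 3 fp t| ≤ M)
    (hMm : ∀ t, |iteratedDeriv 3 fm t| ≤ M) (hc : ∀ t, c ≤ σ * (deriv fp t - deriv fm t))
    (hε : 4 * M * ε ^ 2 ≤ c) :
    Integrable (fun s => boundaryValue ε fp fm (φ s, ψ s)) P ∧
      ∫ s, boundaryValue ε fp fm (φ s, ψ s) ∂P ≤ foliationCandidate σ ε fp fm x := by
  have hae : (fun s => boundaryValue ε fp fm (φ s, ψ s)) =ᵐ[P]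
      fun s => foliationCandidate σ ε fp fm (φ s, ψ s) := by
    filter_upwards [h.abs_snd] with s hs
    exact boundaryValue_eq_foliationCandidate σ hε0 fp fm hs
  rw [integrable_congr hae, integral_congr_ae hae]
  have hBg := hasDiagonalSupergradient_foliationCandidate hσ hε0 hfp hfm hMp hMm hc hε
  have hQg := hasDiagonalSupergradient_quarticMajorant ε
  have hBc : Continuous (foliationCandidate σ ε fp fm) :=
    continuous_foliationCandidate hfp.continuous hfm.continuous
  have hB1 : Continuous (foliationCandidateFst σ ε fp fm) := continuous_foliationCandidate
    (hfp.continuous_deriv (by norm_num)) (hfm.continuous_deriv (by norm_num))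
  have hB2 : Continuous (foliationCandidateSnd σ ε fp fm) :=
    continuous_foliationCandidateSnd hfp hfm
  have hQc : Continuous (quarticMajorant ε) := by
    unfold quarticMajorant
    fun_prop
  -- The majorant is itself nonnegative and diagonally concave, so `Q(φ, ψ)` is integrable and can
  -- be subtracted again.
  obtain ⟨hQi, hQ⟩ := h.integral_comp_le hF hQc (by fun_prop) (by fun_prop) hQg (K := 0)
    fun y hy => by
      have := pow_four_le_quarticMajorant hy
      have : 0 ≤ y.1 ^ 4 := by positivity
      linarith
  have key : ∀ δ : ℝ, 0 < δ →
      Integrable (fun s => foliationCandidate σ ε fp fm (φ s, ψ s)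
        + δ * quarticMajorant ε (φ s, ψ s)) P ∧
      ∫ s, (foliationCandidate σ ε fp fm (φ s, ψ s) + δ * quarticMajorant ε (φ s, ψ s)) ∂P
        ≤ foliationCandidate σ ε fp fm x + δ * quarticMajorant ε x := fun δ hδ => by
    obtain ⟨K, hK⟩ := exists_neg_le_foliationCandidate_add hσ hε0 hfp hfm hMp hMm hδ
    exact h.integral_comp_le hF (hBc.add (hQc.const_mul δ)) (by fun_prop) (by fun_prop)
      (hBg.add (hQg.const_mul hδ.le)) hK
  have hBi : Integrable (fun s => foliationCandidate σ ε fp fm (φ s, ψ s)) P := by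
    simpa [Pi.sub_def] using (key 1 one_pos).1.sub (hQi.const_mul 1)
  refine ⟨hBi, le_of_forall_pos_le_add fun η hη => ?_⟩
  have hQ0 : 0 ≤ ∫ s, quarticMajorant ε (φ s, ψ s) ∂P := by
    refine integral_nonneg_of_ae ?_
    filter_upwards [h.abs_snd] with s hs
    have := pow_four_le_quarticMajorant (x := (φ s, ψ s)) (abs_le.1 hs.le)
    have h4 : 0 ≤ φ s ^ 4 := by positivity
    exact h4.trans this
  set Q := quarticMajorant ε x
  have hQx : 0 ≤ Q := hQ0.trans hQ
  -- This `δ` makes `δ Q ≤ η`; the added 1 avoids dividing by zero.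
  have hδ : 0 < η / (Q + 1) := by positivity
  have h1 := (key _ hδ).2
  rw [integral_add hBi (hQi.const_mul _), integral_const_mul] at h1
  have h2 : η / (Q + 1) * Q ≤ η := by
    rw [div_mul_eq_mul_div, div_le_iff₀ (by positivity)]
    nlinarith
  have h3 := mul_nonneg hδ.le hQ0
  linarith

/-- The supremum is attained by a pair on the endpoints of one segment: `ψ = ε` with probability
`(x₂ + ε) / (2 ε)`, and `φ` is an affine function of `ψ` with slope `σ`. Conditioning preserves this
relation, so any filtration is allowed. -/
theorem foliationCandidate_mem_bellmanValues [StandardBorelSpace S] [NullSingletonClass P]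
    (ℱ : Filtration ℕ m) (hσ : σ * σ = 1) (hε : 0 < ε) (fp fm : ℝ → ℝ) {x : ℝ × ℝ}
    (hx : x ∈ strip ε) : foliationCandidate σ ε fp fm x ∈ bellmanValues P ℱ ε fp fm x := by
  obtain ⟨A, hA, hPA⟩ := exists_measurableSet_measureReal_eq P (r := (x.2 + ε) / (2 * ε))
    (div_nonneg (by linarith [hx.1]) (by positivity))
    (by rw [div_le_one (by positivity)]; linarith [hx.2])
  set ψ : S → ℝ := fun s => A.indicator (fun _ => 2 * ε) s - ε with hψ
  set φ : S → ℝ := fun s => (x.1 - σ * x.2) + σ * ψ s with hφ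
  have hψi : Integrable ψ P := ((integrable_const _).indicator hA).sub (integrable_const _)
  have hφi : Integrable φ P := (integrable_const _).add (hψi.const_mul _)
  have hψm : ∫ s, ψ s ∂P = x.2 := by
    rw [hψ, integral_sub ((integrable_const _).indicator hA) (integrable_const _),
      integral_indicator hA, setIntegral_const, hPA]
    simp
    field_simp
    ring
  have hφm : ∫ s, φ s ∂P = x.1 := by
    rw [hφ, integral_add (integrable_const _) (hψi.const_mul _), integral_const_mul, hψm]
    simp
  have habs : ∀ s, |ψ s| = ε := fun s => by
    by_cases hs : s ∈ A
    · simp [hψ, hs, two_mul, abs_of_pos hε]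
    · simp [hψ, hs, abs_of_pos hε]
  have hcond : ∀ n, ∀ᵐ s ∂P, (P[φ|ℱ n]) s = (x.1 - σ * x.2) + σ * (P[ψ|ℱ n]) s := fun n => by
    have h1 := condExp_add (μ := P) (integrable_const (x.1 - σ * x.2)) (hψi.const_mul σ) (ℱ n)
    have h2 := condExp_smul (μ := P) σ ψ (ℱ n)
    filter_upwards [h1, h2] with s h1 h2
    rw [condExp_const (ℱ.le n)] at h1
    exact h1.trans (congrArg _ h2)
  refine ⟨φ, ψ, ⟨hφi, hψi, ⟨fun _ _ => σ, fun n => ⟨measurable_const, ?_, ?_⟩⟩, hφm, hψm,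
    .of_forall habs⟩, ?_⟩
  · refine .of_forall fun _ => ?_
    rcases mul_self_eq_one_iff.1 hσ with rfl | rfl <;> simp
  · filter_upwards [hcond n, hcond (n + 1)] with s h1 h2
    rw [h1, h2]
    linear_combination -((P[ψ|ℱ (n + 1)]) s - (P[ψ|ℱ n]) s) * hσ
  · have h1 : ∀ s, boundaryValue ε fp fm (φ s, ψ s) = _ := fun s =>
      (boundaryValue_eq_foliationCandidate σ hε fp fm (habs s)).trans
        (foliationCandidate_segment σ ε fp fm hε (u := x.1 - σ * x.2) (by simp [hφ]))
    simp_rw [h1]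
    rw [foliationCandidate_segment σ ε fp fm hε rfl, integral_add (by fun_prop)
      (hψi.const_mul _), integral_const_mul, hψm]
    simp

variable [StandardBorelSpace S] [NullSingletonClass P]

theorem isGreatest_bellmanValues (hF : IsDenseFiltration P ℱ) (hσ : σ * σ = 1) (hε0 : 0 < ε)
    (hfp : ContDiff ℝ 3 fp) (hfm : ContDiff ℝ 3 fm) (hMp : ∀ t, |iteratedDeriv 3 fp t| ≤ M)
    (hMm : ∀ t, |iteratedDeriv 3 fm t| ≤ M) (hc : ∀ t, c ≤ σ * (deriv fp t - deriv fm t))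
    (hε : 4 * M * ε ^ 2 ≤ c) {x : ℝ × ℝ} (hx : x ∈ strip ε) :
    IsGreatest (bellmanValues P ℱ ε fp fm x) (foliationCandidate σ ε fp fm x) := by
  refine ⟨foliationCandidate_mem_bellmanValues ℱ hσ hε0 fp fm hx, ?_⟩
  rintro _ ⟨φ, ψ, h, rfl⟩
  exact (h.integral_boundaryValue_le hF hσ hε0 hfp hfm hMp hMm hc hε).2

theorem bellman_eq_foliationCandidate (hF : IsDenseFiltration P ℱ) (hσ : σ * σ = 1) (hε0 : 0 < ε)
    (hfp : ContDiff ℝ 3 fp) (hfm : ContDiff ℝ 3 fm) (hMp : ∀ t, |iteratedDeriv 3 fp t| ≤ M)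
    (hMm : ∀ t, |iteratedDeriv 3 fm t| ≤ M) (hc : ∀ t, c ≤ σ * (deriv fp t - deriv fm t))
    (hε : 4 * M * ε ^ 2 ≤ c) :
    EqOn (bellman P ℱ ε fp fm) (foliationCandidate σ ε fp fm) (strip ε) := fun _ hx =>
  (isGreatest_bellmanValues hF hσ hε0 hfp hfm hMp hMm hc hε hx).csSup_eq

theorem bellmanWellDefined (hF : IsDenseFiltration P ℱ) (hσ : σ * σ = 1) (hε0 : 0 < ε)
    (hfp : ContDiff ℝ 3 fp) (hfm : ContDiff ℝ 3 fm) (hMp : ∀ t, |iteratedDeriv 3 fp t| ≤ M)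
    (hMm : ∀ t, |iteratedDeriv 3 fm t| ≤ M) (hc : ∀ t, c ≤ σ * (deriv fp t - deriv fm t))
    (hε : 4 * M * ε ^ 2 ≤ c) : BellmanWellDefined P ℱ ε fp fm := fun x hx =>
  ⟨fun _ _ h => (h.integral_boundaryValue_le hF hσ hε0 hfp hfm hMp hMm hc hε).1, by
    rw [bellman_eq_foliationCandidate hF hσ hε0 hfp hfm hMp hMm hc hε hx]
    exact (isGreatest_bellmanValues hF hσ hε0 hfp hfm hMp hMm hc hε hx).isLUB⟩

end Bellman

/-! ### From the candidate to the foliations -/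

theorem DiagonallyConcaveOn.congr {Ω : Set (ℝ × ℝ)} {B B' : ℝ × ℝ → ℝ}
    (h : DiagonallyConcaveOn Ω B) (hB : EqOn B B' Ω) : DiagonallyConcaveOn Ω B' := fun y hy =>
  ⟨(h y hy).1.congr fun _ ht => hB ht, (h y hy).2.congr fun _ ht => hB ht⟩

theorem rightDomain_univ (ε : ℝ) : rightDomain ε univ = strip ε := by
  ext x
  simp [rightDomain, rightSegment]

theorem leftDomain_univ (ε : ℝ) : leftDomain ε univ = strip ε := by
  ext x
  simp [leftDomain, leftSegment]

theorem hasRightFoliation_of_eqOn {ε : ℝ} (hε : 0 < ε) {fp fm : ℝ → ℝ} {B : ℝ × ℝ → ℝ}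
    (hB : EqOn B (foliationCandidate 1 ε fp fm) (strip ε))
    (hc : DiagonallyConcaveOn (strip ε) (foliationCandidate 1 ε fp fm)) :
    HasRightFoliation ε fp fm B univ where
  concave := rightDomain_univ ε ▸ hc.congr hB.symm
  boundary x hx h := by
    rw [boundaryValue_eq_foliationCandidate 1 hε fp fm h, hB (rightDomain_univ ε ▸ hx)]
  linear u _ := ⟨_, _, _, fun x hx =>
    (hB hx.1).trans (foliationCandidate_segment 1 ε fp fm hε (by rw [one_mul]; exact hx.2))⟩

theorem hasLeftFoliation_of_eqOn {ε : ℝ} (hε : 0 < ε) {fp fm : ℝ → ℝ} {B : ℝ × ℝ → ℝ}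
    (hB : EqOn B (foliationCandidate (-1) ε fp fm) (strip ε))
    (hc : DiagonallyConcaveOn (strip ε) (foliationCandidate (-1) ε fp fm)) :
    HasLeftFoliation ε fp fm B univ where
  concave := leftDomain_univ ε ▸ hc.congr hB.symm
  boundary x hx h := by
    rw [boundaryValue_eq_foliationCandidate (-1) hε fp fm h, hB (leftDomain_univ ε ▸ hx)]
  linear u _ := ⟨_, _, _, fun x hx => (hB hx.1).trans
    (foliationCandidate_segment (-1) ε fp fm hε (by rw [neg_one_mul, sub_neg_eq_add]; exact hx.2))⟩

/-- A continuous function bounded away from zero in absolute value has constant sign. -/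
theorem forall_le_or_forall_le_neg {h : ℝ → ℝ} (hh : Continuous h) {c : ℝ} (hc : 0 < c)
    (hsep : ∀ t, c ≤ |h t|) : (∀ t, c ≤ h t) ∨ ∀ t, c ≤ -h t := by
  by_contra! hcon
  obtain ⟨⟨a, ha⟩, ⟨b, hb⟩⟩ := hcon
  have ha' : h a ≤ 0 := by
    rcases le_abs.1 (hsep a) with h1 | h1 <;> linarith
  have hb' : 0 ≤ h b := by
    rcases le_abs.1 (hsep b) with h1 | h1 <;> linarith
  obtain ⟨t, ht⟩ := mem_range_of_exists_le_of_exists_ge hh ⟨a, ha'⟩ ⟨b, hb'⟩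
  have := hsep t
  rw [ht, abs_zero] at this
  linarith

theorem proposition061101 (fp fm : ℝ → ℝ)
    (hfp : ContDiff ℝ 3 fp) (hfm : ContDiff ℝ 3 fm)
    (hbound : ∃ M : ℝ, ∀ t : ℝ, |iteratedDeriv 3 fp t| ≤ M ∧ |iteratedDeriv 3 fm t| ≤ M)
    (hsep : ∃ c : ℝ, 0 < c ∧ ∀ t : ℝ, c ≤ |deriv fp t - deriv fm t|) :
    ∃ ε₀ : ℝ, 0 < ε₀ ∧ ∀ ε : ℝ, 0 < ε → ε < ε₀ →
      ∀ (S : Type*) [MeasurableSpace S] [StandardBorelSpace S]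
        (P : Measure S) [IsProbabilityMeasure P] [NullSingletonClass P]
        (ℱ : Filtration ℕ ‹MeasurableSpace S›), IsDenseFiltration P ℱ →
        BellmanWellDefined P ℱ ε fp fm ∧
        ((∀ t : ℝ, 0 < deriv fp t - deriv fm t) →
          HasRightFoliation ε fp fm (bellman P ℱ ε fp fm) univ) ∧
        ((∀ t : ℝ, deriv fp t - deriv fm t < 0) →
          HasLeftFoliation ε fp fm (bellman P ℱ ε fp fm) univ) := by
  obtain ⟨M, hM⟩ := hbound
  obtain ⟨c, hc, hsep⟩ := hsep
  have hMp := fun t => (hM t).1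
  have hMm := fun t => (hM t).2
  have hM0 : 0 ≤ M := (abs_nonneg _).trans (hMp 0)
  -- With `ε < 1`, `4 M ε² ≤ (4 M + 1) ε < c`; the added 1 covers the case `M = 0`.
  refine ⟨min 1 (c / (4 * M + 1)), lt_min one_pos (by positivity), fun ε hε0 hε => ?_⟩
  have hε' : 4 * M * ε ^ 2 ≤ c := by
    have h1 := hε.trans_le (min_le_left _ _)
    have h2 := hε.trans_le (min_le_right _ _)
    rw [lt_div_iff₀ (by positivity)] at h2
    nlinarith [mul_nonneg hM0 hε0.le]
  intro S _ _ P _ _ ℱ hF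
  have hcont : Continuous fun t => deriv fp t - deriv fm t :=
    (hfp.continuous_deriv (by norm_num)).sub (hfm.continuous_deriv (by norm_num))
  rcases forall_le_or_forall_le_neg hcont hc hsep with h | h
  · have hσ : (1 : ℝ) * 1 = 1 := by norm_num
    have h' : ∀ t, c ≤ 1 * (deriv fp t - deriv fm t) := by simpa using h
    exact ⟨bellmanWellDefined hF hσ hε0 hfp hfm hMp hMm h' hε',
      fun _ => hasRightFoliation_of_eqOn hε0
        (bellman_eq_foliationCandidate hF hσ hε0 hfp hfm hMp hMm h' hε')
        (hasDiagonalSupergradient_foliationCandidate hσ hε0 hfp hfm hMp hMm h' hε').diagonallyConcaveOn,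
      fun hneg => absurd (hneg 0) (by linarith [h 0])⟩
  · have hσ : (-1 : ℝ) * -1 = 1 := by norm_num
    have h' : ∀ t, c ≤ -1 * (deriv fp t - deriv fm t) := by simpa using h
    exact ⟨bellmanWellDefined hF hσ hε0 hfp hfm hMp hMm h' hε',
      fun hpos => absurd (hpos 0) (by linarith [h 0]),
      fun _ => hasLeftFoliation_of_eqOn hε0
        (bellman_eq_foliationCandidate hF hσ hε0 hfp hfm hMp hMm h' hε')
        (hasDiagonalSupergradient_foliationCandidate hσ hε0 hfp hfm hMp hMm h' hε').diagonallyConcaveOn⟩
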